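/- **Theorem 5.5.** Let $P$ be a poset with no infinite antichain and let $\alpha$ be a countable ordinal. Then the following five properties are equivalent: (i) $P$ is $\alpha$-bqo; (ii) $(P;\le_{\rm succ})$ is $\alpha$-bqo; (iii) $(P;\le_{\rm pred})$ is $\alpha$-bqo; (iv) $(P;\le_{\rm crit})$ is $\alpha$-bqo; (v) the set $AM(P)$ of maximal antichains of $P$, ordered by domination ($A\le B$ iff for every $x\in A$ there is $y\in B$ with $x\le y$), is $\alpha$-bqo. Here $a\le_{\rm pred}b$ means that $x<a$ implies $x<b$ for every $x\in P$; $a\le_{\rm succ}b$ means that $b<y$ implies $a<y$ for every $y\in P$; and $a\le_{\rm crit}b$ means that both $a\le_{\rm pred}b$ and $a\le_{\rm succ}b$. Finite subsets of $\mathbb N$ are identified with their increasing enumerations. A *barrier* is an infinite set $B$ of finite subsets of $\mathbb N$, pairwise incomparable under inclusion, such that every infinite $X\subseteq\bigcup B$ has a nonempty initial segment belonging to $B$; every barrier is well ordered by the lexicographic order, and its *order type* is the type of this well-order. For finite $s,t\subseteq\mathbb N$ write $s\triangleleft t$ if there is a finite $r\subseteq\mathbb N$ such that $s$ is a proper initial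 segment of $r$ and $t$ is $r$ with its least element removed. A quasi-ordered set $(Q;\le)$ is *$\alpha$-bqo* ($\alpha$-better-quasi-ordered) if for every barrier $B$ of order type at most $\alpha$ and every map $f:B\to Q$ there are $s,t\in B$ with $s\triangleleft t$ and $f(s)\le f(t)$. -/

import Mathlib

open scoped Ordinal

/-- `s ≤_in X`: the finite set `s`, listed increasingly, is an initial segment of the
(finite or infinite) set `X ⊆ ℕ`, listed increasingly. -/
def InitSeg (s : Finset ℕ) (X : Set ℕ) : Prop :=
  (s : Set ℕ) ⊆ X ∧ ∀ a ∈ s, ∀ b ∈ X, b < a → b ∈ s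

/-- The domain of a family of finite subsets of `ℕ`: the union of its members. -/
def familyUnion (B : Set (Finset ℕ)) : Set ℕ :=
  {n | ∃ s ∈ B, n ∈ s}

/-- A block: an infinite family `B` of finite subsets of `ℕ` such that every infinite subset of
the union of `B` has a nonempty initial segment in `B`. -/
def IsBlock (B : Set (Finset ℕ)) : Prop :=
  B.Infinite ∧
    ∀ X : Set ℕ, X ⊆ familyUnion B → X.Infinite → ∃ s ∈ B, s.Nonempty ∧ InitSeg s X

/-- A barrier: a block whose members are pairwise incomparable under inclusion. -/
def IsBarrier (B : Set (Finset ℕ)) : Prop :=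
  IsBlock B ∧ IsAntichain (· ⊆ ·) B

/-- `*r`: the set `r` with its least element deleted (and `*∅ = ∅`). -/
def deleteMin (r : Finset ℕ) : Finset ℕ :=
  r.filter fun x => ∃ y ∈ r, y < x

/-- `s ◁ t`: there is a finite `r ⊆ ℕ` such that `s` is a proper initial segment of `r` and
`t = *r`. -/
def Triangle (s t : Finset ℕ) : Prop :=
  ∃ r : Finset ℕ, InitSeg s r ∧ s ≠ r ∧ t = deleteMin r

/-- The strict lexicographic order on the members of a family of finite subsets of `ℕ`, each
identified with the increasing list of its elements. -/
def LexLT (B : Set (Finset ℕ)) (s t : B) : Prop :=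
  (s : Finset ℕ).sort (· ≤ ·) < (t : Finset ℕ).sort (· ≤ ·)

/-- The family `B`, ordered lexicographically, has order type at most `α`.  (Barriers are always
well ordered lexicographically, so that for them the first component is no restriction.) -/
def LexTypeLE (B : Set (Finset ℕ)) (α : Ordinal.{0}) : Prop :=
  ∃ _ : IsWellOrder B (LexLT B), Ordinal.type (LexLT B) ≤ α

/-- The map `f` from `B` to the quasi-ordered set `(Q, r)` is good. -/
def IsGood {Q : Type*} (r : Q → Q → Prop) {B : Set (Finset ℕ)} (f : B → Q) : Prop :=
  ∃ s t : B, Triangle s t ∧ r (f s) (f t)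

/-- The quasi-ordered set `(Q, r)` is `α`-better-quasi-ordered: every map from a barrier of order
type at most `α` to `Q` is good. -/
def IsAlphaBqo (α : Ordinal.{0}) {Q : Type*} (r : Q → Q → Prop) : Prop :=
  ∀ B : Set (Finset ℕ), IsBarrier B → LexTypeLE B α → ∀ f : B → Q, IsGood r f

/-- `a ≤_pred b`: every element strictly below `a` is strictly below `b`. -/
def PredLE {P : Type*} [PartialOrder P] (a b : P) : Prop :=
  ∀ x : P, x < a → x < b

/-- `a ≤_succ b`: every element strictly above `b` is strictly above `a`. -/
def SuccLE {P : Type*} [PartialOrder P] (a b : P) : Prop :=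
  ∀ y : P, b < y → a < y

/-- `a ≤_crit b`: both `a ≤_pred b` and `a ≤_succ b`. -/
def CritLE {P : Type*} [PartialOrder P] (a b : P) : Prop :=
  PredLE a b ∧ SuccLE a b

/-- `AM(P)`: the set of maximal antichains of `P`. -/
def MaxAntichains (P : Type*) [PartialOrder P] : Type _ :=
  {A : Set P // IsMaxAntichain (· ≤ ·) A}

/-- The domination order on the maximal antichains of `P`. -/
def DomLE {P : Type*} [PartialOrder P] (A B : MaxAntichains P) : Prop :=
  ∀ x ∈ A.1, ∃ y ∈ B.1, x ≤ y

open Filter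

/-! ### Initial segments and barriers -/

/-! Since `a ≤ b` implies `CritLE a b`, hence `SuccLE` and `PredLE`, the weight lies in returning to
`≤` and in treating `DomLE`.

Descending sequences are bad for `≤_pred` and `≤_succ`, so with finite antichains `P` is
well-quasi-ordered. Then `exists_companion` gives, for a bad `f`, a map `g` on a subbarrier with `f
s < g s`, and `¬ f s ≤ g t` when `s ◁ t`. If `g s ≤_pred g t`, then `f s < g s` forces `f s < g t`,
so `g` is bad for `≤_pred`. If `f s ≤_succ f t`, then `f t < g t` forces the same, so `f` is bad for
`≤_succ`.

The companion comes from a nonprincipal ultrafilter. Call a finite set decided if `f` is generically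
constant on its continuations. Each `s` has a decided initial segment `v ∪ {m}` with `v` undecided.
The values at `v ∪ {n}` are not generically constant in `n`, so the wqo makes them strictly
increase; `g s` is such a value with `n` beyond `s`. If `r ◁ s` and `a = min r`, a rank argument
shows that `{a} ∪ u` is decided for some initial segment `u` of `v`. Replacing `m` by `n` thus
leaves the value at `r` unchanged, and badness of `f` passes to the pair.

For `DomLE`, maximal antichains are finite, so the ultrafilter selects one undominated element from
each (`IsAlphaBqo.finite_domination`). Conversely, the least maximal antichain through `a` reduces
`≤_pred` to `DomLE` (`IsAlphaBqo.predLE_of_domLE`). -/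

lemma InitSeg.trans {u v : Finset ℕ} {X : Set ℕ} (h₁ : InitSeg u v) (h₂ : InitSeg v X) :
    InitSeg u X :=
  ⟨h₁.1.trans h₂.1, fun a ha b hb hba => h₁.2 a ha b (h₂.2 a (h₁.1 ha) b hb hba) hba⟩

lemma InitSeg.of_subset {u v : Finset ℕ} {X : Set ℕ} (h₁ : InitSeg u X) (h₂ : InitSeg v X)
    (h : u ⊆ v) : InitSeg u v :=
  ⟨by exact_mod_cast h, fun a ha b hb hba => h₁.2 a ha b (h₂.1 hb) hba⟩

lemma InitSeg.total {u v : Finset ℕ} {X : Set ℕ} (h₁ : InitSeg u X) (h₂ : InitSeg v X) :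
    u ⊆ v ∨ v ⊆ u := by
  by_contra! h
  obtain ⟨a, ha, hav⟩ := Finset.not_subset.1 h.1
  obtain ⟨b, hb, hbu⟩ := Finset.not_subset.1 h.2
  rcases lt_trichotomy a b with hab | rfl | hab
  · exact hav (h₂.2 b hb a (h₁.1 ha) hab)
  · exact hav hb
  · exact hbu (h₁.2 a ha b (h₂.1 hb) hab)

lemma InitSeg.refl (u : Finset ℕ) : InitSeg u u := ⟨subset_rfl, fun _ _ _ hb _ => hb⟩

lemma InitSeg.subset {u v : Finset ℕ} (h : InitSeg u v) : u ⊆ v := by exact_mod_cast h.1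

lemma InitSeg.of_insert {v : Finset ℕ} {n : ℕ} {X : Set ℕ} (hn : ∀ a ∈ v, a < n)
    (h : InitSeg (insert n v) X) : InitSeg v X := by
  refine ⟨fun a ha => h.1 (by simp [Finset.mem_coe.1 ha]), fun a ha b hb hba => ?_⟩
  have := h.2 a (by simp [ha]) b hb hba
  rcases Finset.mem_insert.1 this with rfl | h'
  · exact absurd (hn a ha) (by omega)
  · exact h'

lemma InitSeg.lt {u : Finset ℕ} {X : Set ℕ} (h : InitSeg u X) {n : ℕ} (hn : n ∈ X) (hnu : n ∉ u) :
    ∀ a ∈ u, a < n := by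
  intro a ha
  rcases lt_trichotomy a n with h' | rfl | h'
  · exact h'
  · exact absurd ha hnu
  · exact absurd (h.2 a ha n hn h') hnu

lemma InitSeg.insert_insert {u : Finset ℕ} {X : Set ℕ} (h : InitSeg u X) {a : ℕ}
    (ha : ∀ x ∈ X, a < x) : InitSeg (insert a u) (insert a X) := by
  refine ⟨?_, ?_⟩
  · rw [Finset.coe_insert]; exact Set.insert_subset_insert h.1
  · intro x hx b hb hbx
    rcases Finset.mem_insert.1 hx with rfl | hx
    · rcases hb with rfl | hb
      · simp
      · exact absurd (ha b hb) (by omega)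
    · rcases hb with rfl | hb
      · simp
      · exact Finset.mem_insert_of_mem (h.2 x hx b hb hbx)

/-- An initial segment can be grown to any larger one by adding one element at a time. -/
lemma InitSeg.grow {Φ : Finset ℕ → Prop} {s : Finset ℕ}
    (step : ∀ w n, InitSeg w s → n ∈ s → (∀ a ∈ w, a < n) → w ≠ s → Φ w → Φ (insert n w)) :
    ∀ w, InitSeg w s → Φ w → Φ s := by
  suffices H : ∀ k w, (s \ w).card = k → InitSeg w s → Φ w → Φ s from
    fun w => H _ w rfl
  intro k
  induction k with
  | zero =>
    intro w hk hw hΦ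
    have : s ⊆ w := by simpa using hk
    rwa [← hw.subset.antisymm this]
  | succ k ih =>
    intro w hk hw hΦ
    have hne : (s \ w).Nonempty := by rw [← Finset.card_pos]; omega
    set n := (s \ w).min' hne with hn
    have hmem : n ∈ s \ w := Finset.min'_mem _ _
    rw [Finset.mem_sdiff] at hmem
    have hlt := hw.lt (Finset.mem_coe.2 hmem.1) hmem.2
    refine ih (insert n w) ?_ ⟨?_, ?_⟩ (step w n hw hmem.1 hlt ?_ hΦ)
    · rw [Finset.sdiff_insert, Finset.card_erase_of_mem (Finset.mem_sdiff.2 hmem)]; omega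
    · rw [Finset.coe_insert]
      exact Set.insert_subset (by exact_mod_cast hmem.1) hw.1
    · intro a ha b hb hba
      by_contra hbw
      rw [Finset.mem_insert, not_or] at hbw
      rcases Finset.mem_insert.1 ha with rfl | ha
      · have := Finset.min'_le (s \ w) b (by
          rw [Finset.mem_sdiff]; exact ⟨by exact_mod_cast hb, hbw.2⟩)
        omega
      · exact hbw.2 (hw.2 a ha b hb hba)
    · rintro rfl; exact hmem.2 hmem.1

lemma IsBarrier.eq_of_subset {B : Set (Finset ℕ)} (hB : IsBarrier B) {s t : Finset ℕ}
    (hs : s ∈ B) (ht : t ∈ B) (h : s ⊆ t) : s = t :=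
  hB.2.eq hs ht h

lemma IsBarrier.eq_of_initSeg {B : Set (Finset ℕ)} (hB : IsBarrier B) {s t : Finset ℕ}
    {X : Set ℕ} (hs : s ∈ B) (ht : t ∈ B) (hsX : InitSeg s X) (htX : InitSeg t X) : s = t := by
  rcases hsX.total htX with h | h
  · exact hB.eq_of_subset hs ht h
  · exact (hB.eq_of_subset ht hs h).symm

lemma IsBarrier.nonempty_of_mem {B : Set (Finset ℕ)} (hB : IsBarrier B) {s : Finset ℕ}
    (hs : s ∈ B) : s.Nonempty := by
  by_contra h
  rw [Finset.not_nonempty_iff_eq_empty] at h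
  subst h
  apply hB.1.1
  refine (Set.finite_singleton (∅ : Finset ℕ)).subset fun t ht => ?_
  exact (hB.eq_of_subset hs ht (Finset.empty_subset t)).symm

lemma subset_familyUnion {B : Set (Finset ℕ)} {s : Finset ℕ} (hs : s ∈ B) :
    (s : Set ℕ) ⊆ familyUnion B :=
  fun _ hn => ⟨s, hs, hn⟩

lemma IsBarrier.infinite_familyUnion {B : Set (Finset ℕ)} (hB : IsBarrier B) :
    (familyUnion B).Infinite := by
  intro h
  apply hB.1.1
  refine (h.toFinset.powerset.finite_toSet).subset fun s hs => ?_
  simp only [Finset.coe_powerset, Set.mem_preimage, Set.mem_powerset_iff]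
  simpa using subset_familyUnion hs

/-- The members of `B` contained in `Y`. -/
def restrictFamily (B : Set (Finset ℕ)) (Y : Set ℕ) : Set (Finset ℕ) :=
  {s | s ∈ B ∧ (s : Set ℕ) ⊆ Y}

lemma IsBarrier.restrict {B : Set (Finset ℕ)} (hB : IsBarrier B) {Y : Set ℕ}
    (hY : Y ⊆ familyUnion B) (hinf : Y.Infinite) : IsBarrier (restrictFamily B Y) := by
  have key : ∀ X : Set ℕ, X ⊆ Y → X.Infinite → ∃ s ∈ restrictFamily B Y, s.Nonempty ∧
      InitSeg s X := by
    intro X hX hXi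
    obtain ⟨s, hs, hne, hsX⟩ := hB.1.2 X (hX.trans hY) hXi
    exact ⟨s, ⟨hs, hsX.1.trans hX⟩, hne, hsX⟩
  refine ⟨⟨?_, ?_⟩, hB.2.subset fun s hs => hs.1⟩
  · intro hfin
    have hU : (familyUnion (restrictFamily B Y)).Finite := by
      have : familyUnion (restrictFamily B Y) = ⋃ s ∈ restrictFamily B Y, (s : Set ℕ) := by
        ext n; simp [familyUnion]
      rw [this]
      exact hfin.biUnion fun s _ => s.finite_toSet
    -- If finitely many members remained, deleting their union from `Y` would still leave an
    -- infinite set, with a member of the family inside it.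
    obtain ⟨s, hs, ⟨n, hn⟩, hsX⟩ := key (Y \ familyUnion (restrictFamily B Y)) Set.sdiff_subset
      (hinf.sdiff hU)
    exact (hsX.1 hn).2 ⟨s, hs, hn⟩
  · intro X hX hXi
    exact key X (hX.trans fun n ⟨s, hs, hn⟩ => hs.2 hn) hXi

lemma LexTypeLE.mono {B B' : Set (Finset ℕ)} {α : Ordinal.{0}} (h : B' ⊆ B)
    (hB : LexTypeLE B α) : LexTypeLE B' α := by
  obtain ⟨hw, hle⟩ := hB
  let e : LexLT B' ↪r LexLT B :=
    { toFun := fun s => ⟨s.1, h s.2⟩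
      inj' := fun s t hst => Subtype.ext (congrArg (fun x : B => x.1) hst)
      map_rel_iff' := Iff.rfl }
  have : IsWellOrder B' (LexLT B') := e.isWellOrder
  exact ⟨this, (Ordinal.type_le_iff'.2 ⟨e⟩).trans hle⟩

/-- The witness is `r = {a} ∪ t`. It cannot lie inside `s`: then `t ⊆ s` would give `t = s`,
although `a ∉ t`. -/
lemma triangle_of_initSeg {B : Set (Finset ℕ)} (hB : IsBarrier B) {s t : Finset ℕ}
    (hs : s ∈ B) (ht : t ∈ B) {a : ℕ} {X : Set ℕ} (ha : ∀ x ∈ X, a < x)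
    (hsX : InitSeg s (insert a X)) (htX : InitSeg t X) : Triangle s t := by
  have hta : ∀ x ∈ t, a < x := fun x hx => ha x (htX.1 hx)
  have hr : InitSeg (insert a t) (insert a X) := htX.insert_insert ha
  have hnot : ¬ insert a t ⊆ s := by
    intro h
    have := hB.eq_of_subset ht hs ((Finset.subset_insert a t).trans h)
    subst this
    exact lt_irrefl a (hta a (h (Finset.mem_insert_self a t)))
  refine ⟨insert a t, hsX.of_subset hr ((hsX.total hr).resolve_right hnot), ?_, ?_⟩
  · rintro rfl; exact hnot subset_rfl
  · ext x
    simp only [deleteMin, Finset.mem_filter, Finset.mem_insert]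
    constructor
    · exact fun hx => ⟨Or.inr hx, a, Or.inl rfl, hta x hx⟩
    · rintro ⟨rfl | hx, y, rfl | hy, hyx⟩
      · exact absurd hyx (lt_irrefl _)
      · exact absurd (hta y hy) (by omega)
      · exact hx
      · exact hx

/-- A nonempty initial segment of `r` contains `min r`, which is the element deleted to obtain `t`.
-/
lemma Triangle.exists_min {s t : Finset ℕ} (h : Triangle s t) (hs : s.Nonempty) :
    ∃ a ∈ s, (∀ x ∈ t, a < x) ∧ (∀ x ∈ s, a ≤ x) ∧ InitSeg s (insert a t : Finset ℕ) := by
  obtain ⟨r, hsr, -, rfl⟩ := h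
  obtain ⟨c, hc⟩ := hs
  have hcr : c ∈ r := hsr.subset hc
  set a := r.min' ⟨c, hcr⟩ with ha
  have har : a ∈ r := Finset.min'_mem _ _
  have hmin : ∀ x ∈ r, a ≤ x := fun x hx => Finset.min'_le _ _ hx
  have has : a ∈ s := by
    rcases (hmin c hcr).eq_or_lt with h | h
    · rwa [h]
    · exact hsr.2 c hc a har h
  have hins : insert a (deleteMin r) = r := by
    ext x
    simp only [deleteMin, Finset.mem_filter, Finset.mem_insert]
    constructor
    · rintro (rfl | h)
      · exact har
      · exact h.1
    · intro hx
      rcases (hmin x hx).eq_or_lt with h | h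
      · exact Or.inl h.symm
      · exact Or.inr ⟨hx, a, har, h⟩
  refine ⟨a, has, fun x hx => ?_, fun x hx => hmin x (hsr.subset hx), ?_⟩
  · obtain ⟨-, y, hy, hyx⟩ := Finset.mem_filter.1 hx
    exact (hmin y hy).trans_lt hyx
  · rwa [hins]

/-! ### Generic extensions with respect to an ultrafilter -/

/-- Diagonal intersection along a nonprincipal ultrafilter containing `E`: given sets `A w` in
the ultrafilter, there is an infinite `Y ⊆ E` such that each `n ∈ Y` belongs to all `A w` with `w`
a finite set of smaller elements of `Y`. -/
lemma Ultrafilter.exists_diagonal (U : Ultrafilter ℕ) (hU : (U : Filter ℕ) ≤ cofinite) {E : Set ℕ}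
    (hE : ∀ᶠ n in U, n ∈ E) (A : Finset ℕ → ℕ → Prop) (hA : ∀ w, ∀ᶠ n in U, A w n) :
    ∃ Y : Set ℕ, Y ⊆ E ∧ Y.Infinite ∧
      ∀ w : Finset ℕ, (w : Set ℕ) ⊆ Y → ∀ n ∈ Y, (∀ a ∈ w, a < n) → A w n := by
  have hlt : ∀ a : ℕ, ∀ᶠ n in U, a < n := fun a =>
    hU (by rw [Nat.cofinite_eq_atTop]; exact eventually_gt_atTop a)
  have hnext : ∀ w : Finset ℕ, ∃ n ∈ E, (∀ a ∈ w, a < n) ∧ ∀ v ∈ w.powerset, A v n := by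
    intro w
    have h₁ : ∀ᶠ n in U, ∀ a ∈ w, a < n := (eventually_all_finset w).2 fun a _ => hlt a
    have h₂ : ∀ᶠ n in U, ∀ v ∈ w.powerset, A v n :=
      (eventually_all_finset _).2 fun v _ => hA v
    exact (hE.and (h₁.and h₂)).exists
  choose next hnE hnlt hnA using hnext
  -- `S k` holds the first `k` chosen elements. Each new one meets the conditions of all subsets of
  -- its predecessors.
  let S : ℕ → Finset ℕ := fun k => Nat.rec ∅ (fun _ w => insert (next w) w) k
  have hS : ∀ k, S (k + 1) = insert (next (S k)) (S k) := fun k => rfl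
  have hSmono : Monotone S := monotone_nat_of_le_succ fun k => by
    rw [hS]; exact Finset.subset_insert _ _
  have hx : StrictMono fun k => next (S k) := strictMono_nat_of_lt_succ fun k =>
    hnlt _ _ (by rw [hS]; exact Finset.mem_insert_self _ _)
  refine ⟨Set.range fun k => next (S k), ?_, Set.infinite_range_of_injective hx.injective, ?_⟩
  · rintro _ ⟨k, rfl⟩; exact hnE _
  · rintro w hw _ ⟨k, rfl⟩ hlt
    apply hnA
    rw [Finset.mem_powerset]
    intro a ha
    obtain ⟨j, rfl⟩ := hw ha
    have hjk : j < k := hx.lt_iff_lt.1 (hlt _ ha)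
    exact hSmono (Nat.succ_le_of_lt hjk) (by
      change _ ∈ S (j + 1)
      rw [hS]; exact Finset.mem_insert_self _ _)

lemma exists_ultrafilter {E : Set ℕ} (hE : E.Infinite) :
    ∃ U : Ultrafilter ℕ, (U : Filter ℕ) ≤ cofinite ∧ ∀ᶠ n in U, n ∈ E := by
  have : NeBot (cofinite ⊓ 𝓟 E) := hE.cofinite_inf_principal_neBot
  have h := Ultrafilter.of_le (cofinite ⊓ 𝓟 E)
  exact ⟨Ultrafilter.of _, h.trans inf_le_left, (h.trans inf_le_right) (mem_principal_self E)⟩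

lemma eventually_finset_lt {U : Ultrafilter ℕ} (hU : (U : Filter ℕ) ≤ cofinite) (w : Finset ℕ) :
    ∀ᶠ n in U, ∀ a ∈ w, a < n :=
  (eventually_all_finset w).2 fun a _ =>
    hU (by rw [Nat.cofinite_eq_atTop]; exact eventually_gt_atTop a)

/-- Bar induction along a barrier, with branching measured by an ultrafilter. -/
lemma IsBarrier.induction {B : Set (Finset ℕ)} (hB : IsBarrier B) {U : Ultrafilter ℕ}
    (hU : (U : Filter ℕ) ≤ cofinite) (hE : ∀ᶠ n in U, n ∈ familyUnion B) {Φ : Finset ℕ → Prop}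
    (leaf : ∀ s ∈ B, Φ s) (node : ∀ v, (∀ᶠ n in U, Φ (insert n v)) → Φ v) {v : Finset ℕ}
    (hv : (v : Set ℕ) ⊆ familyUnion B) (hvB : ∀ s ∈ B, s ⊆ v → s = v) : Φ v := by
  by_contra hΦ
  -- For an ultrafilter, failure of `Φ` at a node means failure at almost all children. Failure thus
  -- spreads along `Y` beyond `v`, until a member of `B` contradicts `leaf`.
  obtain ⟨Y, hYE, hYi, hY⟩ := U.exists_diagonal hU (hE.and (eventually_finset_lt hU v))
    (fun w n => ¬ Φ (v ∪ w) → ¬ Φ (insert n (v ∪ w))) (fun w => by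
      by_cases h : Φ (v ∪ w)
      · exact Eventually.of_forall fun n h' => absurd h h'
      · have := mt (node (v ∪ w)) h
        rw [← Ultrafilter.eventually_not] at this
        exact this.mono fun n hn _ => hn)
  have key : ∀ w : Finset ℕ, (w : Set ℕ) ⊆ Y → ¬ Φ (v ∪ w) := by
    intro w
    induction w using Finset.induction_on_max with
    | empty => intro _; simpa using hΦ
    | insert n w hn ih =>
      intro hw
      rw [Finset.coe_insert, Set.insert_subset_iff] at hw
      rw [Finset.union_insert]
      exact hY w hw.2 n hw.1 hn (ih hw.2)
  obtain ⟨t, ht, -, htX⟩ := hB.1.2 (↑v ∪ Y) (Set.union_subset hv fun n hn => (hYE hn).1)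
    (hYi.mono Set.subset_union_right)
  by_cases htv : t ⊆ v
  · exact hΦ (hvB t ht htv ▸ leaf t ht)
  · obtain ⟨n, hnt, hnv⟩ := Finset.not_subset.1 htv
    have hnY : n ∈ Y := (htX.1 hnt).resolve_left (by exact_mod_cast hnv)
    have hvt : v ⊆ t := fun a ha =>
      htX.2 n hnt a (Or.inl ha) ((hYE hnY).2 a ha)
    have := key (t \ v) (fun a ha => by
      rw [Finset.mem_coe, Finset.mem_sdiff] at ha
      exact (htX.1 ha.1).resolve_left (by exact_mod_cast ha.2))
    rw [Finset.union_sdiff_of_subset hvt] at this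
    exact this (leaf t ht)

/-! ### ### Generic values and ranks -/

/-- `Generic U Q v`: iterating for `U`-almost all `n`, replace `v` by `insert n v`, one reaches
finite sets satisfying `Q`. -/
inductive Generic (U : Ultrafilter ℕ) (Q : Finset ℕ → Prop) : Finset ℕ → Prop
  | leaf {s : Finset ℕ} : Q s → Generic U Q s
  | node {v : Finset ℕ} (A : Set ℕ) : A ∈ U → (∀ n ∈ A, Generic U Q (insert n v)) →
      Generic U Q v

namespace Generic

variable {U : Ultrafilter ℕ} {Q : Finset ℕ → Prop}

lemma of_eventually {v : Finset ℕ} (h : ∀ᶠ n in U, Generic U Q (insert n v)) : Generic U Q v :=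
  node _ h fun _ hn => hn

lemma cases' {v : Finset ℕ} (h : Generic U Q v) :
    Q v ∨ ∀ᶠ n in U, Generic U Q (insert n v) := by
  cases h with
  | leaf h => exact Or.inl h
  | node A hA h => exact Or.inr (Filter.mem_of_superset hA h)

lemma exists_superset {v : Finset ℕ} (h : Generic U Q v) : ∃ t, Q t ∧ v ⊆ t := by
  induction h with
  | leaf h => exact ⟨_, h, subset_rfl⟩
  | node A hA _ ih =>
    obtain ⟨n, hn⟩ := U.neBot.nonempty_of_mem hA
    obtain ⟨t, ht, hvt⟩ := ih n hn
    exact ⟨t, ht, (Finset.subset_insert _ _).trans hvt⟩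

variable {B : Set (Finset ℕ)}

/-- A further step from `s` would lead to a member of `B` strictly containing `s`. -/
lemma of_mem (hB : IsBarrier B) (hU : (U : Filter ℕ) ≤ cofinite) (hQ : ∀ s, Q s → s ∈ B)
    {s : Finset ℕ} (hs : s ∈ B) (h : Generic U Q s) : Q s := by
  refine h.cases'.resolve_right fun h' => ?_
  obtain ⟨n, hn, hlt⟩ := (h'.and (eventually_finset_lt hU s)).exists
  obtain ⟨t, ht, hst⟩ := hn.exists_superset
  have := hB.eq_of_subset hs (hQ t ht) ((Finset.subset_insert _ _).trans hst)
  subst this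
  exact lt_irrefl n (hlt n (hst (Finset.mem_insert_self _ _)))

lemma eventually (hQ : ∀ s, Q s → s ∈ B) {v : Finset ℕ} (hv : v ∉ B) (h : Generic U Q v) :
    ∀ᶠ n in U, Generic U Q (insert n v) :=
  h.cases'.resolve_left fun h' => hv (hQ v h')

end Generic

/-- A sequence in a wqo that is not constant on a set of the ultrafilter is generically strictly
increasing. -/
lemma eventually_eventually_lt {P : Type*} [PartialOrder P]
    (hwqo : WellQuasiOrdered (fun a b : P => a ≤ b)) (U : Ultrafilter ℕ) (p : ℕ → P)
    (hp : ∀ q, ¬ ∀ᶠ n in U, p n = q) : ∀ᶠ m in U, ∀ᶠ n in U, p m < p n := by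
  by_contra h
  rw [← Ultrafilter.eventually_not] at h
  -- Equality with `p m` also fails almost everywhere, so failure of `<` becomes failure of `≤`;
  -- iterating builds a bad sequence.
  have h' : ∀ᶠ m in U, ∀ᶠ n in U, ¬ p m ≤ p n := h.mono fun m hm => by
    rw [← Ultrafilter.eventually_not] at hm
    have hne := hp (p m)
    rw [← Ultrafilter.eventually_not] at hne
    exact (hm.and hne).mono fun n hn hle => hn.1 (hle.lt_of_ne fun e => hn.2 e.symm)
  obtain ⟨g, -, hg⟩ := exists_seq_of_forall_finset_exists (fun m => ∀ᶠ n in U, ¬ p m ≤ p n)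
    (fun m n => ¬ p m ≤ p n) fun s hs => by
      have : ∀ᶠ n in U, ∀ m ∈ s, ¬ p m ≤ p n := (eventually_all_finset s).2 hs
      exact (h'.and this).exists
  obtain ⟨m, n, hmn, hle⟩ := hwqo (p ∘ g)
  exact hg m n hmn hle

/-- `RankLE U D β v`: by steps for `U`-almost all `n`, replace `v` by `insert n v`, one reaches
finite sets satisfying `D`, with ordinal rank at most `β`. -/
inductive RankLE (U : Ultrafilter ℕ) (D : Finset ℕ → Prop) : Ordinal.{0} → Finset ℕ → Prop
  | leaf {β : Ordinal.{0}} {v : Finset ℕ} : D v → RankLE U D β v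
  | node {β : Ordinal.{0}} {v : Finset ℕ} (γ : Ordinal.{0}) (A : Set ℕ) : γ < β → A ∈ U →
      (∀ n ∈ A, RankLE U D γ (insert n v)) → RankLE U D β v

namespace RankLE

variable {U : Ultrafilter ℕ} {D : Finset ℕ → Prop}

lemma cases' {β : Ordinal.{0}} {v : Finset ℕ} (h : RankLE U D β v) (hD : ¬ D v) :
    ∃ γ < β, ∀ᶠ n in U, RankLE U D γ (insert n v) := by
  cases h with
  | leaf h => exact absurd h hD
  | node γ A hγ hA h => exact ⟨γ, hγ, Filter.mem_of_superset hA h⟩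

lemma mono {β β' : Ordinal.{0}} {v : Finset ℕ} (h : RankLE U D β v) (hβ : β ≤ β') :
    RankLE U D β' v := by
  cases h with
  | leaf h => exact leaf h
  | node γ A hγ hA h => exact node γ A (hγ.trans_le hβ) hA h

lemma of_eventually {β γ : Ordinal.{0}} {v : Finset ℕ} (hγ : γ < β)
    (h : ∀ᶠ n in U, RankLE U D γ (insert n v)) : RankLE U D β v :=
  node γ _ hγ h fun _ hn => hn

lemma exists_of_eventually {v : Finset ℕ} (h : ∀ᶠ n in U, ∃ β, RankLE U D β (insert n v)) :
    ∃ β, RankLE U D β v := by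
  classical
  -- The default 0 is harmless: it occurs only off a set of the ultrafilter.
  let b : ℕ → Ordinal.{0} := fun n =>
    if h : ∃ β, RankLE U D β (insert n v) then h.choose else 0
  refine ⟨Order.succ (⨆ n, b n), of_eventually (Order.lt_succ _) (h.mono fun n hn => ?_)⟩
  have hb : b n = hn.choose := dif_pos hn
  refine hn.choose_spec.mono ?_
  rw [← hb]
  exact Ordinal.le_iSup b n

/-- The rank of `w` is smaller than the rank of `v`. -/
def Lower (U : Ultrafilter ℕ) (D : Finset ℕ → Prop) (w v : Finset ℕ) : Prop :=
  ∃ γ, RankLE U D γ w ∧ ¬ RankLE U D γ v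

/-- Almost all children of `w` have rank at most one `δ < γ`. Were this so for `v`, its rank would
be at most `γ`; the ultrafilter turns this into almost all children of `v` exceeding `δ`. -/
lemma Lower.eventually {w v : Finset ℕ} (h : Lower U D w v) (hw : ¬ D w) :
    ∀ᶠ n in U, Lower U D (insert n w) (insert n v) := by
  obtain ⟨γ, hγw, hγv⟩ := h
  obtain ⟨δ, hδ, hev⟩ := hγw.cases' hw
  have : ¬ ∀ᶠ n in U, RankLE U D δ (insert n v) := fun h => hγv (of_eventually hδ h)
  rw [← Ultrafilter.eventually_not] at this
  exact (hev.and this).mono fun n hn => ⟨δ, hn⟩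

lemma eventually_lower {v : Finset ℕ} (h : ∃ β, RankLE U D β v) (hv : ¬ D v) :
    ∀ᶠ n in U, Lower U D (insert n v) v := by
  obtain ⟨β, hβ, hmin⟩ := WellFounded.has_min (α := Ordinal.{0}) (r := (· < ·))
    Ordinal.lt_wf {β | RankLE U D β v} h
  obtain ⟨γ, hγ, hev⟩ := RankLE.cases' hβ hv
  exact hev.mono fun n hn => ⟨γ, hn, fun h' => hmin γ h' hγ⟩

end RankLE

/-! ### ### The companion of a bad map -/

/-- Over a wqo, every bad map `f` on a barrier has a companion `g` on a subbarrier with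
`f s < g s` for all `s`, and `¬ f s ≤ g t` whenever `s ◁ t`. -/
theorem exists_companion {P : Type*} [PartialOrder P]
    (hwqo : WellQuasiOrdered (fun a b : P => a ≤ b)) {B : Set (Finset ℕ)} (hB : IsBarrier B)
    (f : B → P) (hf : ¬ IsGood (fun a b : P => a ≤ b) f) :
    ∃ Y : Set ℕ, Y ⊆ familyUnion B ∧ Y.Infinite ∧ ∃ g : Finset ℕ → P,
      (∀ s : B, (s : Set ℕ) ⊆ Y → f s < g s) ∧
      ∀ s t : B, (s : Set ℕ) ⊆ Y → (t : Set ℕ) ⊆ Y → Triangle s t → ¬ f s ≤ g t := by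
  classical
  obtain ⟨U, hU, hE⟩ := exists_ultrafilter hB.infinite_familyUnion
  let Q : P → Finset ℕ → Prop := fun p s => ∃ h : s ∈ B, f ⟨s, h⟩ = p
  have hQ : ∀ p s, Q p s → s ∈ B := fun p s h => h.1
  let Val : Finset ℕ → P → Prop := fun v p => Generic U (Q p) v
  let Dec : Finset ℕ → Prop := fun v => ∃ p, Val v p
  have hValmem : ∀ s (hs : s ∈ B), Val s (f ⟨s, hs⟩) := fun s hs => Generic.leaf ⟨hs, rfl⟩
  have hValmem' : ∀ s (hs : s ∈ B) p, Val s p → f ⟨s, hs⟩ = p := fun s hs p h =>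
    (Generic.of_mem hB hU (hQ p) hs h).2
  have hValuniq : ∀ v p q, Val v p → Val v q → p = q := by
    intro v p q hp hq
    change Generic U (Q p) v at hp
    induction hp with
    | leaf h => obtain ⟨hs, rfl⟩ := h; exact hValmem' _ hs q hq
    | @node v A hA h ih =>
      by_cases hv : v ∈ B
      · rw [← hValmem' v hv q hq, ← hValmem' v hv p (Generic.node A hA h)]
      · have hA' : ∀ᶠ n in U, n ∈ A := hA
        obtain ⟨n, hn, hnA⟩ := ((Generic.eventually (hQ q) hv hq).and hA').exists
        exact ih n hnA hn
  let Up : Finset ℕ → ℕ → ℕ → Prop := fun v m n =>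
    ∃ p q, Val (insert m v) p ∧ Val (insert n v) q ∧ p < q
  -- requirements for the diagonal set
  have r₁ : ∀ w, ∀ᶠ n in U, ∀ p, Val w p → w ∉ B → Val (insert n w) p := by
    intro w
    by_cases hw : Dec w ∧ w ∉ B
    · obtain ⟨⟨p, hp⟩, hwB⟩ := hw
      refine (Generic.eventually (hQ p) hwB hp).mono fun n hn q hq _ => ?_
      rw [hValuniq w q p hq hp]; exact hn
    · exact Eventually.of_forall fun n p hp hwB => absurd ⟨⟨p, hp⟩, hwB⟩ hw
  -- If almost all children of an undecided `w` are decided, their values are not generically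
  -- constant, as that would decide `w`. Otherwise the premise fails for almost all `m`.
  have r₂ : ∀ w, ∀ᶠ m in U, ¬ Dec w → Dec (insert m w) → ∀ᶠ n in U, Up w m n := by
    intro w
    by_cases hw : Dec w
    · exact Eventually.of_forall fun m h => absurd hw h
    by_cases hev : ∀ᶠ m in U, Dec (insert m w)
    · obtain ⟨-, p₀, -⟩ := hev.exists
      let p : ℕ → P := fun m => if h : Dec (insert m w) then h.choose else p₀
      have hp : ∀ m, Dec (insert m w) → Val (insert m w) (p m) := fun m h => by
        have : p m = h.choose := dif_pos h
        rw [this]; exact h.choose_spec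
      have := eventually_eventually_lt hwqo U p fun q hq =>
        hw ⟨q, Generic.of_eventually ((hq.and hev).mono fun n hn => hn.1 ▸ hp n hn.2)⟩
      refine (this.and hev).mono fun m hm _ _ => ?_
      exact (hm.1.and hev).mono fun n hn => ⟨p m, p n, hp m hm.2, hp n hn.2, hn.1⟩
    · rw [← Ultrafilter.eventually_not] at hev
      exact hev.mono fun m hm _ h => absurd h hm
  have r₃ : ∀ w m, ∀ᶠ n in U, (∀ᶠ k in U, Up w m k) → Up w m n := by
    intro w m
    by_cases h : ∀ᶠ k in U, Up w m k
    · exact h.mono fun n hn _ => hn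
    · exact Eventually.of_forall fun n h' => absurd h' h
  have r₄ : ∀ w v, ∀ᶠ n in U, RankLE.Lower U Dec w v → ¬ Dec w →
      RankLE.Lower U Dec (insert n w) (insert n v) := by
    intro w v
    by_cases h : RankLE.Lower U Dec w v ∧ ¬ Dec w
    · exact (h.1.eventually h.2).mono fun n hn _ _ => hn
    · exact Eventually.of_forall fun n h₁ h₂ => absurd ⟨h₁, h₂⟩ h
  have r₅ : ∀ᶠ n in U, ¬ Dec ∅ → RankLE.Lower U Dec {n} ∅ := by
    by_cases h : Dec ∅
    · exact Eventually.of_forall fun n h' => absurd h h'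
    · have : ∃ β, RankLE U Dec β ∅ := by
        refine hB.induction hU hE (Φ := fun v => ∃ β, RankLE U Dec β v)
          (fun s hs => ⟨0, RankLE.leaf ⟨_, hValmem s hs⟩⟩)
          (fun v => RankLE.exists_of_eventually) (by simp) ?_
        intro s _ hs
        exact Finset.subset_empty.1 hs
      exact (RankLE.eventually_lower this h).mono fun n hn _ => by simpa using hn
  obtain ⟨Y, hYE, hYi, hY⟩ := U.exists_diagonal hU hE
    (fun w n => (∀ v ∈ w.powerset, ∀ p, Val v p → v ∉ B → Val (insert n v) p) ∧
      (∀ v ∈ w.powerset, ¬ Dec v → Dec (insert n v) → ∀ᶠ k in U, Up v n k) ∧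
      (∀ v ∈ w.powerset, ∀ m ∈ w, (∀ᶠ k in U, Up v m k) → Up v m n) ∧
      (∀ v ∈ w.powerset, ∀ u ∈ w.powerset, RankLE.Lower U Dec v u → ¬ Dec v →
        RankLE.Lower U Dec (insert n v) (insert n u)) ∧
      (¬ Dec ∅ → RankLE.Lower U Dec {n} ∅))
    (fun w => by
      refine Eventually.and ?_ (Eventually.and ?_ (Eventually.and ?_ (Eventually.and ?_ r₅)))
      · exact (eventually_all_finset _).2 fun v _ => r₁ v
      · exact (eventually_all_finset _).2 fun v _ => r₂ v
      · exact (eventually_all_finset _).2 fun v _ => (eventually_all_finset _).2 fun m _ => r₃ v m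
      · exact (eventually_all_finset _).2 fun v _ => (eventually_all_finset _).2 fun u _ => r₄ v u)
  clear r₁ r₂ r₃ r₄ r₅
  -- values propagate inside `Y`
  have hVal : ∀ s (hs : s ∈ B), (s : Set ℕ) ⊆ Y → ∀ w p, InitSeg w s → Val w p →
      f ⟨s, hs⟩ = p := by
    intro s hs hsY w p hw hp
    refine hValmem' s hs p (InitSeg.grow (Φ := fun w => Val w p) ?_ w hw hp)
    intro w n hw hn hlt hne hp
    exact (hY w (hw.1.trans hsY) n (hsY hn) hlt).1 w (by simp) p hp
      fun hwB => hne (hB.eq_of_subset hwB hs hw.subset)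
  -- members of the barrier inside `Y`
  have hmem : ∀ X : Set ℕ, X ⊆ Y → X.Infinite → ∃ s ∈ B, InitSeg s X := fun X hX hXi => by
    obtain ⟨s, hs, -, hsX⟩ := hB.1.2 X (hX.trans hYE) hXi
    exact ⟨s, hs, hsX⟩
  have hbad : ∀ {a : ℕ} {X : Set ℕ} {s t : Finset ℕ} (hs : s ∈ B) (ht : t ∈ B),
      (∀ x ∈ X, a < x) → InitSeg s (insert a X) → InitSeg t X → ¬ f ⟨s, hs⟩ ≤ f ⟨t, ht⟩ :=
    fun hs ht ha hsX htX hle => hf ⟨_, _, triangle_of_initSeg hB hs ht ha hsX htX, hle⟩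
  -- Otherwise `f` would be constant on members inside `Y`, hence good.
  have hDec0 : ¬ Dec ∅ := by
    rintro ⟨p, hp⟩
    obtain ⟨a, haY⟩ := hYi.nonempty
    have hsub : {x ∈ Y | a < x} ⊆ Y := Set.sep_subset _ _
    have hinf : {x ∈ Y | a < x}.Infinite := by
      refine (hYi.sdiff (Set.finite_Iic a)).mono fun x hx => ⟨hx.1, ?_⟩
      simpa using hx.2
    have h0 : ∀ s : Finset ℕ, InitSeg ∅ (s : Set ℕ) := fun s => ⟨by simp, by simp⟩
    obtain ⟨t, ht, htX⟩ := hmem _ hsub hinf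
    have hsub' : insert a {x ∈ Y | a < x} ⊆ Y := Set.insert_subset haY hsub
    obtain ⟨s, hs, hsX⟩ := hmem _ hsub' (hinf.mono (Set.subset_insert _ _))
    refine hbad hs ht (fun x hx => hx.2) hsX htX ?_
    rw [hVal s hs (hsX.1.trans hsub') ∅ p (h0 s) hp, hVal t ht (htX.1.trans hsub) ∅ p (h0 t) hp]
  -- the minimal decided initial segment
  have hmin : ∀ s : Finset ℕ, Dec s → ∃ v m, InitSeg (insert m v) s ∧ (∀ a ∈ v, a < m) ∧
      ¬ Dec v ∧ Dec (insert m v) := by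
    intro s hs
    suffices H : ∀ w, InitSeg w s → Dec w → ∃ v m, InitSeg (insert m v) s ∧ (∀ a ∈ v, a < m) ∧
      ¬ Dec v ∧ Dec (insert m v) from H s (InitSeg.refl s) hs
    intro w
    induction w using Finset.induction_on_max with
    | empty => exact fun _ h => absurd h hDec0
    | insert m v hm ih =>
      intro hw hD
      by_cases hv : Dec v
      · exact ih (by exact InitSeg.of_insert hm (by exact_mod_cast hw)) hv
      · exact ⟨v, m, by exact_mod_cast hw, hm, hv, hD⟩
  -- As `v` grows along `s`, adjoining `a` keeps the rank strictly smaller until some `{a} ∪ u`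
  -- becomes decided.
  have hlower : ∀ s : Finset ℕ, (s : Set ℕ) ⊆ Y → ∀ a ∈ Y, (∀ x ∈ s, a < x) → ∀ v, InitSeg v s →
      RankLE.Lower U Dec (insert a v) v ∨ ∃ u, InitSeg u v ∧ Dec (insert a u) ∧ ¬ Dec u := by
    intro s hs a ha hlt v
    induction v using Finset.induction_on_max with
    | empty =>
      intro _
      exact Or.inl (by simpa using (hY ∅ (by simp) a ha (by simp)).2.2.2.2 hDec0)
    | insert n v hn ih =>
      intro hv
      have hvs : InitSeg v s := InitSeg.of_insert hn hv
      have hvv : InitSeg v (insert n v : Finset ℕ) := InitSeg.of_insert hn (InitSeg.refl _)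
      rcases ih hvs with h | ⟨u, hu, hu'⟩
      · have hnd : ¬ Dec v := by
          rintro hd
          obtain ⟨γ, -, hγ⟩ := h
          exact hγ (RankLE.leaf hd)
        by_cases hd : Dec (insert a v)
        · exact Or.inr ⟨v, hvv, hd, hnd⟩
        · left
          rw [Finset.insert_comm]
          have hns : n ∈ s := hv.subset (Finset.mem_insert_self _ _)
          refine (hY (insert a v) ?_ n (hs hns) ?_).2.2.2.1 _ (by simp) _ ?_ h hd
          · rw [Finset.coe_insert]
            exact Set.insert_subset ha (hvs.1.trans hs)
          · intro x hx
            rcases Finset.mem_insert.1 hx with rfl | hx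
            · exact hlt n hns
            · exact hn x hx
          · rw [Finset.mem_powerset]; exact Finset.subset_insert _ _
      · exact Or.inr ⟨u, hu.trans hvv, hu'⟩
  have hchoice : ∀ s : B, (s : Set ℕ) ⊆ Y → ∃ q, f s < q ∧ ∃ v m n, InitSeg (insert m v) s ∧
      (∀ a ∈ v, a < m) ∧ ¬ Dec v ∧ Dec (insert m v) ∧ n ∈ Y ∧ (∀ a ∈ (s : Finset ℕ), a < n) ∧
      Val (insert n v) q := by
    rintro ⟨s, hs⟩ hsY
    obtain ⟨v, m, hvs, hm, hv, hmv⟩ := hmin s ⟨_, hValmem s hs⟩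
    obtain ⟨n, hnY, hn⟩ := (hYi.sdiff (Set.finite_Iic (s.sup id))).nonempty
    have hns : ∀ a ∈ s, a < n := fun a ha => by
      have h₁ : a ≤ s.sup id := Finset.le_sup (f := id) ha
      have h₂ : s.sup id < n := by simpa using hn
      omega
    have hms : m ∈ s := hvs.subset (Finset.mem_insert_self _ _)
    have hvs' : InitSeg v s := InitSeg.of_insert hm hvs
    have hev := (hY v (hvs'.1.trans hsY) m (hsY hms) hm).2.1 v (by simp) hv hmv
    obtain ⟨p, q, hp, hq, hpq⟩ := (hY s hsY n hnY hns).2.2.1 v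
      (Finset.mem_powerset.2 hvs'.subset) m hms hev
    refine ⟨q, ?_, v, m, n, hvs, hm, hv, hmv, hnY, hns, hq⟩
    rwa [hVal s hs hsY _ p hvs hp]
  obtain ⟨s₀, hs₀⟩ := hB.1.1.nonempty
  have : Nonempty P := ⟨f ⟨s₀, hs₀⟩⟩
  choose! g hg using hchoice
  refine ⟨Y, hYE, hYi, fun s => if h : s ∈ B then g ⟨s, h⟩ else f ⟨s₀, hs₀⟩, ?_, ?_⟩
  · rintro ⟨s, hs⟩ hsY
    simpa [hs] using (hg ⟨s, hs⟩ hsY).1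
  rintro ⟨r, hr⟩ ⟨s, hs⟩ hrY hsY htri
  obtain ⟨-, v, m, n, hvs, hm, hv, hmv, hnY, hns, hq⟩ := hg ⟨s, hs⟩ hsY
  simp only [hs, dif_pos]
  set q := g ⟨s, hs⟩ with hqdef
  simp only at hrY hsY hns hvs htri
  obtain ⟨a, har, hlt, -, hrs⟩ := htri.exists_min (hB.nonempty_of_mem hr)
  have haY : a ∈ Y := hrY har
  have hms : m ∈ s := hvs.subset (Finset.mem_insert_self _ _)
  have hvs' : InitSeg v s := InitSeg.of_insert hm hvs
  have hvm : InitSeg v (insert m v : Finset ℕ) := InitSeg.of_insert hm (InitSeg.refl _)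
  -- A decided set satisfies every rank bound, so nothing is lower than `insert m v`. Since `u` is
  -- undecided, it is not `insert m v` itself and lies within `v`.
  obtain ⟨u, huv, ⟨p, hp⟩, -⟩ : ∃ u, InitSeg u v ∧ Dec (insert a u) ∧ ¬ Dec u := by
    rcases hlower s hsY a haY hlt _ hvs with h | ⟨u, hu, hu', hu''⟩
    · obtain ⟨γ, -, hγ⟩ := h
      exact absurd (RankLE.leaf hmv) hγ
    · refine ⟨u, ?_, hu', hu''⟩
      refine hu.of_subset hvm fun x hx => ?_
      rcases Finset.mem_insert.1 (hu.subset hx) with rfl | h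
      · exfalso
        apply hu''
        have : u = insert x v := by
          refine hu.subset.antisymm fun y hy => ?_
          rcases Finset.mem_insert.1 hy with rfl | hy'
          · exact hx
          · exact hu.2 x hx y (by exact_mod_cast hy) (hm y hy')
        rwa [this]
      · exact h
  -- a generic continuation of `v`
  set X : Set ℕ := ↑v ∪ {x ∈ Y | n ≤ x} with hX
  have hXY : X ⊆ Y := Set.union_subset (hvs'.1.trans hsY) (Set.sep_subset _ _)
  have hXi : X.Infinite := by
    refine (hYi.sdiff (Set.finite_Iio n)).mono fun x hx => Or.inr ⟨hx.1, ?_⟩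
    simpa using hx.2
  have haX : ∀ x ∈ X, a < x := by
    rintro x (hx | hx)
    · exact hlt x (hvs'.subset (by exact_mod_cast hx))
    · exact ((hlt m hms).trans (hns m hms)).trans_le hx.2
  have hvn : ∀ x ∈ v, x < n := fun x hx => hns x (hvs'.subset hx)
  have hvX : InitSeg v X := by
    refine ⟨Set.subset_union_left, ?_⟩
    rintro x hx b (hb | hb) hbx
    · exact_mod_cast hb
    · exact absurd (hvn x hx) (by have := hb.2; omega)
  have hvnX : InitSeg (insert n v) X := by
    refine ⟨?_, ?_⟩
    · rw [Finset.coe_insert]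
      exact Set.insert_subset (Or.inr ⟨hnY, le_rfl⟩) hvX.1
    · rintro x hx b (hb | hb) hbx
      · exact Finset.mem_insert_of_mem (by exact_mod_cast hb)
      · exfalso
        have := hb.2
        rcases Finset.mem_insert.1 hx with rfl | hx
        · omega
        · have := hvn x hx; omega
  obtain ⟨t, ht, htX⟩ := hmem X hXY hXi
  have hinX : insert a X ⊆ Y := Set.insert_subset haY hXY
  obtain ⟨r', hr', hrX⟩ := hmem (insert a X) hinX (hXi.mono (Set.subset_insert _ _))
  -- Otherwise `t ⊆ v ⊆ s`, forcing `t = s`, which contains `m ∉ v`.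
  have hvnt : InitSeg (insert n v) t := by
    refine hvnX.of_subset htX ?_
    rcases hvnX.total htX with h | h
    · exact h
    · by_cases hnt : n ∈ t
      · intro x hx
        rcases Finset.mem_insert.1 hx with rfl | hx
        · exact hnt
        · exact htX.2 n hnt x (Or.inl (by exact_mod_cast hx)) (hvn x hx)
      · exfalso
        have htv : t ⊆ v := fun x hx =>
          (Finset.mem_insert.1 (h hx)).resolve_left (by rintro rfl; exact hnt hx)
        have := hB.eq_of_subset ht hs (htv.trans hvs'.subset)
        subst this
        exact lt_irrefl m (hm m (htv hms))
  have hfq : f ⟨t, ht⟩ = q := hVal t ht (htX.1.trans hXY) _ q hvnt hq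
  have hus : InitSeg (insert a u) (insert a s : Finset ℕ) := by
    rw [Finset.coe_insert]
    exact (huv.trans hvs').insert_insert hlt
  have huX : InitSeg (insert a u) (insert a X) := (huv.trans hvX).insert_insert haX
  -- Either both continue the decided set `{a} ∪ u`, or one lies inside it and the two coincide.
  have hfr : f ⟨r, hr⟩ = f ⟨r', hr'⟩ := by
    rcases hus.total hrs with h | h
    · rcases huX.total hrX with h' | h'
      · rw [hVal r hr hrY _ p (hus.of_subset hrs h) hp,
          hVal r' hr' (hrX.1.trans hinX) _ p (huX.of_subset hrX h') hp]
      · have := hB.eq_of_subset hr' hr (h'.trans h)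
        subst this; rfl
    · have := hB.eq_of_initSeg hr hr' ((hrs.of_subset hus h).trans huX) hrX
      subst this; rfl
  rw [← hfq, hfr]
  exact hbad hr' ht haX hrX htX

/-! ### ### Subbarriers and finite domination -/

/-- A quasi-order in which some bad map lives on a subbarrier is not `α`-bqo. -/
lemma not_isAlphaBqo_of_restrict {Q : Type*} {r : Q → Q → Prop} {α : Ordinal.{0}}
    {B : Set (Finset ℕ)} (hB : IsBarrier B) (hα : LexTypeLE B α) {Y : Set ℕ}
    (hYE : Y ⊆ familyUnion B) (hYi : Y.Infinite) (g : B → Q)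
    (hg : ∀ s t : B, (s : Set ℕ) ⊆ Y → (t : Set ℕ) ⊆ Y → Triangle s t → ¬ r (g s) (g t)) :
    ¬ IsAlphaBqo α r := by
  intro h
  obtain ⟨s, t, hst, hr⟩ := h (restrictFamily B Y) (hB.restrict hYE hYi)
    (hα.mono fun s hs => hs.1) (fun s => g ⟨s, s.2.1⟩)
  exact hg ⟨s, s.2.1⟩ ⟨t, t.2.1⟩ s.2.2 t.2.2 hst hr

/-- If some barrier has type at most `α`, an `α`-bqo has no bad sequences. -/
lemma IsAlphaBqo.wellQuasiOrdered {Q : Type*} {r : Q → Q → Prop} {α : Ordinal.{0}}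
    (h : IsAlphaBqo α r) {B : Set (Finset ℕ)} (hB : IsBarrier B) (hα : LexTypeLE B α) :
    WellQuasiOrdered r := by
  intro p
  obtain ⟨s, t, hst, hr⟩ := h B hB hα (fun s => p (sInf (s : Set ℕ)))
  refine ⟨_, _, ?_, hr⟩
  obtain ⟨a, has, hat, hmin, -⟩ := hst.exists_min (hB.nonempty_of_mem s.2)
  have h₁ : sInf ((s : Finset ℕ) : Set ℕ) ≤ a := Nat.sInf_le has
  have h₂ : sInf ((t : Finset ℕ) : Set ℕ) ∈ ((t : Finset ℕ) : Set ℕ) :=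
    Nat.sInf_mem (hB.nonempty_of_mem t.2)
  exact h₁.trans_lt (hat _ h₂)

/-- Choosing witnesses in finite sets: if `P` is `α`-bqo then so is any family of finite subsets
of `P` ordered by domination. -/
lemma IsAlphaBqo.finite_domination {Q R : Type*} {r : Q → Q → Prop} {α : Ordinal.{0}}
    (h : IsAlphaBqo α r) (F : R → Set Q) (hF : ∀ x, (F x).Finite) :
    IsAlphaBqo α (fun x y : R => ∀ a ∈ F x, ∃ b ∈ F y, r a b) := by
  classical
  intro B hB hα f
  by_contra hf
  obtain ⟨U, hU, hE⟩ := exists_ultrafilter hB.infinite_familyUnion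
  let C : Q → Finset ℕ → Prop := fun x t => ∃ ht : t ∈ B, ∀ y ∈ F (f ⟨t, ht⟩), ¬ r x y
  have hC : ∀ x s, C x s → s ∈ B := fun x s h => h.1
  have hchoice : ∀ s : B, ∃ x ∈ F (f s), ∀ a ∈ (s : Finset ℕ), (∀ y ∈ (s : Finset ℕ), a ≤ y) →
      Generic U (C x) ((s : Finset ℕ).erase a) := by
    intro s
    obtain ⟨s, hs⟩ := s
    obtain ⟨a, ha, hmin⟩ : ∃ a ∈ s, ∀ y ∈ s, a ≤ y :=
      ⟨s.min' (hB.nonempty_of_mem hs), Finset.min'_mem _ _, fun y hy => Finset.min'_le _ _ hy⟩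
    have hlt : ∀ x ∈ s.erase a, a < x := fun x hx =>
      (hmin x (Finset.mem_of_mem_erase hx)).lt_of_ne (Finset.ne_of_mem_erase hx).symm
    -- The premise built into `Φ` ensures that every leaf `t` reached satisfies `s ◁ t`.
    have key : (InitSeg (s.erase a) (s.erase a) ∧ ∀ x ∈ s.erase a, a < x) →
        ∃ x ∈ F (f ⟨s, hs⟩), Generic U (C x) (s.erase a) := by
      refine hB.induction hU hE (Φ := fun v => (InitSeg (s.erase a) v ∧ ∀ x ∈ v, a < x) →
        ∃ x ∈ F (f ⟨s, hs⟩), Generic U (C x) v) ?_ ?_ ?_ ?_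
      · rintro t ht ⟨hst, hat⟩
        have hs' : InitSeg s (insert a (t : Set ℕ)) := by
          have := hst.insert_insert (a := a) hat
          rwa [Finset.insert_erase ha] at this
        have htri := triangle_of_initSeg hB hs ht (a := a) hat hs' (InitSeg.refl t)
        have : ¬ ∀ x ∈ F (f ⟨s, hs⟩), ∃ b ∈ F (f ⟨t, ht⟩), r x b := fun h' =>
          hf ⟨⟨s, hs⟩, ⟨t, ht⟩, htri, h'⟩
        push Not at this
        obtain ⟨x, hx, hxt⟩ := this
        exact ⟨x, hx, Generic.leaf ⟨ht, hxt⟩⟩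
      · rintro v hv ⟨hsv, hav⟩
        have hev : ∀ᶠ n in U, ∃ x ∈ F (f ⟨s, hs⟩), Generic U (C x) (insert n v) := by
          filter_upwards [hv, eventually_finset_lt hU v, eventually_finset_lt hU {a}]
            with n hn hlt han
          have han : a < n := han a (by simp)
          refine hn ⟨hsv.trans ?_, ?_⟩
          · exact InitSeg.of_insert hlt (InitSeg.refl _)
          · intro x hx
            rcases Finset.mem_insert.1 hx with rfl | hx
            · exact han
            · exact hav x hx
        -- Finiteness of `F (f s)` lets the ultrafilter fix one witness for almost all `n`.
        have hmem : (⋃ x ∈ F (f ⟨s, hs⟩), {n | Generic U (C x) (insert n v)}) ∈ U := by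
          filter_upwards [hev] with n hn
          simpa using hn
        rw [Ultrafilter.finite_biUnion_mem_iff (hF _)] at hmem
        obtain ⟨x, hx, hxU⟩ := hmem
        exact ⟨x, hx, Generic.of_eventually hxU⟩
      · exact (Finset.coe_subset.2 (Finset.erase_subset a s)).trans (subset_familyUnion hs)
      · intro t ht hts
        have := hB.eq_of_subset ht hs (hts.trans (Finset.erase_subset a s))
        subst this
        exact absurd (hts ha) (Finset.notMem_erase a t)
    obtain ⟨x, hx, hgen⟩ := key ⟨InitSeg.refl _, hlt⟩
    refine ⟨x, hx, fun b hb hbmin => ?_⟩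
    rwa [le_antisymm (hbmin a ha) (hmin b hb)]
  choose x hxF hx using hchoice
  obtain ⟨Y, hYE, hYi, hY⟩ := U.exists_diagonal hU hE
    (fun w n => ∀ s ∈ w.powerset, ∀ v ∈ w.powerset, ∀ hs : s ∈ B, v ∉ B →
      Generic U (C (x ⟨s, hs⟩)) v → Generic U (C (x ⟨s, hs⟩)) (insert n v))
    (fun w => by
      refine (eventually_all_finset _).2 fun s _ => (eventually_all_finset _).2 fun v _ => ?_
      by_cases h' : ∃ hs : s ∈ B, v ∉ B ∧ Generic U (C (x ⟨s, hs⟩)) v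
      · obtain ⟨hs, hv, hgen⟩ := h'
        exact (Generic.eventually (hC _) hv hgen).mono fun n hn _ _ _ => hn
      · exact Eventually.of_forall fun n hs hv hgen => absurd ⟨hs, hv, hgen⟩ h')
  refine not_isAlphaBqo_of_restrict hB hα hYE hYi x ?_ h
  rintro ⟨s, hs⟩ ⟨t, ht⟩ hsY htY hst hr
  obtain ⟨a, ha, hat, hmin, hst⟩ := hst.exists_min (hB.nonempty_of_mem hs)
  simp only at hsY htY ha hat hmin hst
  have hst' : InitSeg (s.erase a) t := by
    refine ⟨fun y hy => ?_, fun y hy b hb hby => ?_⟩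
    · rw [Finset.mem_coe, Finset.mem_erase] at hy
      exact_mod_cast (Finset.mem_insert.1 (hst.subset hy.2)).resolve_left hy.1
    · rw [Finset.mem_erase]
      refine ⟨(hat b hb).ne', hst.2 y (Finset.mem_of_mem_erase hy) b ?_ hby⟩
      rw [Finset.coe_insert]
      exact Or.inr hb
  have hgen : Generic U (C (x ⟨s, hs⟩)) t := by
    suffices H : InitSeg (s.erase a) t ∧ Generic U (C (x ⟨s, hs⟩)) t from H.2
    refine InitSeg.grow (Φ := fun w => InitSeg (s.erase a) w ∧ Generic U (C (x ⟨s, hs⟩)) w) ?_ _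
      hst' ⟨InitSeg.refl _, hx ⟨s, hs⟩ a ha hmin⟩
    rintro w n hwt hnt hlt hne ⟨hsw, hw⟩
    refine ⟨hsw.trans (InitSeg.of_insert hlt (InitSeg.refl _)), ?_⟩
    -- Adjoining `a`, though `a ∉ t`, makes `s` a subset of the finite set to which the diagonal
    -- condition is applied.
    have hwa : (((insert a w : Finset ℕ)) : Set ℕ) ⊆ Y := by
      rw [Finset.coe_insert]
      exact Set.insert_subset (hsY ha) (hwt.1.trans htY)
    refine hY (insert a w) hwa n (htY hnt) ?_ s ?_ w ?_ hs ?_ hw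
    · intro y hy
      rcases Finset.mem_insert.1 hy with rfl | hy
      · exact hat n hnt
      · exact hlt y hy
    · rw [Finset.mem_powerset, ← Finset.insert_erase ha]
      exact Finset.insert_subset_insert a hsw.subset
    · rw [Finset.mem_powerset]; exact Finset.subset_insert _ _
    · exact fun hwB => hne (hB.eq_of_subset hwB ht hwt.subset)
  obtain ⟨_, hbad⟩ := Generic.of_mem hB hU (hC _) ht hgen
  exact hbad _ (hxF ⟨t, ht⟩) hr

/-! ### ### Comparing the orders on `P` and its maximal antichains -/

lemma wellQuasiOrdered_of_no_descending {P : Type*} [PartialOrder P]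
    (hP : ∀ A : Set P, IsAntichain (· ≤ ·) A → A.Finite)
    (hd : ∀ p : ℕ → P, ¬ StrictAnti p) : WellQuasiOrdered (fun a b : P => a ≤ b) := by
  have hwf : WellFoundedLT P := by
    refine ⟨?_⟩
    rw [RelEmbedding.wellFounded_iff_isEmpty]
    exact ⟨fun e => hd e fun i j hij => e.map_rel_iff.2 hij⟩
  exact (wellQuasiOrderedLE_iff.2 ⟨hwf, hP⟩).wqo

section

variable {P : Type*} [PartialOrder P]

lemma CritLE.of_le {a b : P} (h : a ≤ b) : CritLE a b :=
  ⟨fun _ hx => hx.trans_le h, fun _ hy => h.trans_lt hy⟩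

lemma IsAlphaBqo.mono {Q : Type*} {r r' : Q → Q → Prop} {α : Ordinal.{0}} (h : IsAlphaBqo α r)
    (hr : ∀ a b, r a b → r' a b) : IsAlphaBqo α r' := fun B hB hα f => by
  obtain ⟨s, t, hst, hs⟩ := h B hB hα f
  exact ⟨s, t, hst, hr _ _ hs⟩

/-- A descending sequence is bad for `≤_pred`. -/
lemma not_strictAnti_of_predLE (h : WellQuasiOrdered (PredLE (P := P))) (p : ℕ → P) :
    ¬ StrictAnti p := fun hp => by
  obtain ⟨i, j, hij, hle⟩ := h p
  exact lt_irrefl _ (hle (p j) (hp hij))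

/-- A descending sequence is bad for `≤_succ`. -/
lemma not_strictAnti_of_succLE (h : WellQuasiOrdered (SuccLE (P := P))) (p : ℕ → P) :
    ¬ StrictAnti p := fun hp => by
  obtain ⟨i, j, hij, hle⟩ := h p
  exact lt_irrefl _ (hle (p i) (hp hij))

lemma exists_maxAntichain (a : P) : ∃ A : MaxAntichains P, a ∈ A.1 := by
  obtain ⟨M, hM, hmax⟩ := zorn_subset_nonempty {A : Set P | IsAntichain (· ≤ ·) A}
    (fun c hc hchain _ => ⟨⋃₀ c, (Set.pairwise_sUnion hchain.directedOn).2 hc,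
      fun s hs => Set.subset_sUnion_of_mem hs⟩) {a} (by simp [IsAntichain])
  refine ⟨⟨M, hmax.prop, fun t ht hMt => ?_⟩, hM rfl⟩
  exact hMt.antisymm (hmax.2 ht hMt)

/-- Extend each `p i` to a maximal antichain `A i`. Domination of `A i` by `A j` with `i < j` puts
an element of `A j` strictly above `p j ∈ A j`. -/
lemma not_strictAnti_of_domLE (h : WellQuasiOrdered (DomLE (P := P))) (p : ℕ → P) :
    ¬ StrictAnti p := fun hp => by
  choose A hA using fun i => exists_maxAntichain (p i)
  obtain ⟨i, j, hij, hle⟩ := h A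
  obtain ⟨y, hy, hpy⟩ := hle (p i) (hA i)
  have hlt : p j < y := (hp hij).trans_le hpy
  exact (A j).2.1 (hA j) hy hlt.ne hlt.le

/-- The least maximal antichain containing `a`. -/
lemma isMaxAntichain_minimal [WellFoundedLT P] (a : P) :
    IsMaxAntichain (· ≤ ·) {x : P | Minimal (fun y => ¬ y < a) x} := by
  refine ⟨setOfPred_minimal_antichain _, fun t ht hsub => hsub.antisymm fun z hz => ?_⟩
  have hza : ¬ z < a := by
    intro hza
    have ha : Minimal (fun y => ¬ y < a) a := ⟨lt_irrefl a, fun y hy hya => by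
      rcases hya.eq_or_lt with rfl | h
      · exact le_rfl
      · exact absurd h hy⟩
    exact ht hz (hsub ha) hza.ne hza.le
  obtain ⟨y, hyz, hy⟩ := exists_minimal_le_of_wellFoundedLT (fun y => ¬ y < a) z hza
  have : y = z := ht.eq (hsub hy) hz hyz
  rwa [← this]

/-- Let `M a` be the least maximal antichain through `a`. If `M a ≤ M b` and `x < a` but not `x <
b`, some `y ≤ x` lies in `M b`, and some `z ∈ M b` lies above `a`; then `y < z` inside an antichain.
-/
lemma IsAlphaBqo.predLE_of_domLE {α : Ordinal.{0}} (h : IsAlphaBqo α (DomLE (P := P))) :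
    IsAlphaBqo α (PredLE (P := P)) := by
  intro B hB hα f
  -- The given `B` is what makes descending sequences impossible; with no barrier of type at most
  -- `α`, the claim is vacuous.
  have hwf : WellFoundedLT P := by
    refine ⟨?_⟩
    rw [RelEmbedding.wellFounded_iff_isEmpty]
    exact ⟨fun e => not_strictAnti_of_domLE (h.wellQuasiOrdered hB hα) e
      fun i j hij => e.map_rel_iff.2 hij⟩
  obtain ⟨s, t, hst, hle⟩ := h B hB hα fun s => ⟨_, isMaxAntichain_minimal (f s)⟩
  refine ⟨s, t, hst, fun x hx => ?_⟩
  by_contra hxt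
  obtain ⟨y, hyx, hy⟩ := exists_minimal_le_of_wellFoundedLT (fun y => ¬ y < f t) x hxt
  obtain ⟨z, hz, hsz⟩ := hle (f s) ⟨lt_irrefl _, fun y hy hya => by
    rcases hya.eq_or_lt with h | h
    · exact h.ge
    · exact absurd h hy⟩
  have hyz : y < z := (hyx.trans_lt hx).trans_le hsz
  exact setOfPred_minimal_antichain (fun y => ¬ y < f t) hy hz hyz.ne hyz.le

lemma IsAlphaBqo.le_of_predLE (hP : ∀ A : Set P, IsAntichain (· ≤ ·) A → A.Finite)
    {α : Ordinal.{0}} (h : IsAlphaBqo α (PredLE (P := P))) :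
    IsAlphaBqo α (fun a b : P => a ≤ b) := by
  intro B hB hα f
  by_contra hf
  have hwqo := wellQuasiOrdered_of_no_descending hP
    (not_strictAnti_of_predLE (h.wellQuasiOrdered hB hα))
  obtain ⟨Y, hYE, hYi, g, hfg, hg⟩ := exists_companion hwqo hB f hf
  exact not_isAlphaBqo_of_restrict hB hα hYE hYi (fun s => g s)
    (fun s t hs ht hst hle => hg s t hs ht hst (hle _ (hfg s hs)).le) h

lemma IsAlphaBqo.le_of_succLE (hP : ∀ A : Set P, IsAntichain (· ≤ ·) A → A.Finite)
    {α : Ordinal.{0}} (h : IsAlphaBqo α (SuccLE (P := P))) :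
    IsAlphaBqo α (fun a b : P => a ≤ b) := by
  intro B hB hα f
  by_contra hf
  have hwqo := wellQuasiOrdered_of_no_descending hP
    (not_strictAnti_of_succLE (h.wellQuasiOrdered hB hα))
  obtain ⟨Y, hYE, hYi, g, hfg, hg⟩ := exists_companion hwqo hB f hf
  exact not_isAlphaBqo_of_restrict hB hα hYE hYi f
    (fun s t hs ht hst hle => hg s t hs ht hst (hle _ (hfg t ht)).le) h

end

theorem theorem5p5 {P : Type*} [PartialOrder P]
    (hP : ∀ A : Set P, IsAntichain (· ≤ ·) A → A.Finite)
    (α : Ordinal.{0}) (hα : α < ω₁) :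
    List.TFAE
      [IsAlphaBqo α (fun a b : P => a ≤ b),
       IsAlphaBqo α (SuccLE (P := P)),
       IsAlphaBqo α (PredLE (P := P)),
       IsAlphaBqo α (CritLE (P := P)),
       IsAlphaBqo α (DomLE (P := P))] := by
  tfae_have 1 → 4 := fun h => h.mono fun _ _ => CritLE.of_le
  tfae_have 4 → 2 := fun h => h.mono fun _ _ hab => hab.2
  tfae_have 4 → 3 := fun h => h.mono fun _ _ hab => hab.1
  tfae_have 2 → 1 := IsAlphaBqo.le_of_succLE hP
  tfae_have 3 → 1 := IsAlphaBqo.le_of_predLE hP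
  tfae_have 1 → 5 := fun h => h.finite_domination (fun A : MaxAntichains P => A.1)
    fun A => hP A.1 A.2.1
  tfae_have 5 → 3 := IsAlphaBqo.predLE_of_domLE
  tfae_finish
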